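/- All spaces are Hausdorff. Let $L=2^{\omega_1}_{\mathrm{lex}}$ be the set of all functions $\omega_1\to\{0,1\}$, ordered lexicographically and given the order topology, and let $K=2^{\omega}\times L$, where $2^\omega=\{0,1\}^{\omega}$ has the product topology. Call points $a,b$ of a compact space $X$ pin equivalent if there are a compact space $Y$, a continuous surjection $f\colon Y\to X$ and a homeomorphism $g\colon Y\to Y$ with $g(f^{-1}\{a\})=f^{-1}\{b\}$; call $X$ pin homogeneous if every two points of $X$ are pin equivalent. The $\pi$-character of a point $a\in X$ is the least cardinality of a family of nonempty open subsets of $X$ such that every neighborhood of $a$ contains a member of the family. For directed sets $P,Q$, write $P\le_T Q$ if there is a map $f\colon Q\to P$ such that for every $p_0\in P$ there is $q_0\in Q$ with $f(q)\ge p_0$ for all $q\ge q_0$; $P$ and $Q$ are Tukey equivalent if $P\le_T Q\le_T P$. The point $a$ has Tukey type $P$ if its neighborhood filter, ordered by $\supseteq$, is Tukey equivalent to $P$. **Theorem.** The space $K=2^\omega\times 2^{\omega_1}_{\mathrm{lex}}$ is compact (Hausdorff) and pin homogeneous. Every point of $K$ has $\pi$-character $\omega$ or $\omega_1$, and both values are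 attained. Every point of $K$ has Tukey type $\omega\times\omega_1$ (with the coordinatewise order). -/

import Mathlib

open scoped Ordinal Cardinal Topology

universe u v

/-- `2^α_lex` for an ordinal `α`: all functions from (the ordinals below) `α` to `2 = {0, 1}`, here
`Bool` with `false < true`, ordered lexicographically. -/
def LexPower (α : Ordinal.{0}) : Type := Lex (α.ToType → Bool)

/-- The lexicographic order: `f < g` iff `f i < g i` at the least `i` where `f` and `g` differ. -/
noncomputable instance (α : Ordinal.{0}) : LinearOrder (LexPower α) :=
  inferInstanceAs (LinearOrder (Lex (α.ToType → Bool)))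

/-- The topology of `2^α_lex` is the order topology. -/
noncomputable instance (α : Ordinal.{0}) : TopologicalSpace (LexPower α) := Preorder.topology (LexPower α)

instance (α : Ordinal.{0}) : OrderTopology (LexPower α) := ⟨rfl⟩

/-- `K = 2^ω × 2^{ω₁}_lex`, the product of the Cantor space `2^ω` (product topology) and
`2^{ω₁}_lex` (order topology), with the product topology. -/
abbrev CantorLexProduct : Type := (ℕ → Bool) × LexPower ω₁

/-- Pin equivalence of two subsets `A`, `B` of a compact Hausdorff space `X`: there are a compact
Hausdorff space `Y`, a continuous surjection `f : Y → X` and a homeomorphism `g : Y → Y` such that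
`g (f⁻¹ A) = f⁻¹ B`. -/
def PinEquivSets {X : Type u} [TopologicalSpace X] (A B : Set X) : Prop :=
  ∃ (Y : Type u) (_ : TopologicalSpace Y) (_ : CompactSpace Y) (_ : T2Space Y)
    (f : Y → X) (g : Y ≃ₜ Y),
    Continuous f ∧ Function.Surjective f ∧ g '' (f ⁻¹' A) = f ⁻¹' B

/-- Pin equivalence of points. -/
def PinEquiv {X : Type u} [TopologicalSpace X] (a b : X) : Prop :=
  PinEquivSets ({a} : Set X) {b}

/-- A compact Hausdorff space is pin homogeneous if all pairs of points are pin equivalent. -/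
def PinHomogeneous (X : Type u) [TopologicalSpace X] : Prop :=
  ∀ a b : X, PinEquiv a b

/-- A family `F` of nonempty open sets is a local `π`-base at `a` if every neighborhood of `a`
contains an element of `F`. -/
def IsLocalPiBase {X : Type u} [TopologicalSpace X] (a : X) (F : Set (Set X)) : Prop :=
  (∀ U ∈ F, IsOpen U ∧ U.Nonempty) ∧ ∀ N ∈ 𝓝 a, ∃ U ∈ F, U ⊆ N

/-- The `π`-character of a point `a`: the least cardinality of a local `π`-base at `a`. (There is
always one, namely the family of all nonempty open sets.) -/
noncomputable def piCharacter {X : Type u} [TopologicalSpace X] (a : X) : Cardinal.{u} :=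
  sInf {κ | ∃ F : Set (Set X), IsLocalPiBase a F ∧ Cardinal.mk F = κ}

/-- `P ≤_T Q`: there is a convergent map `f : Q → P`, that is, for every `p₀` there is `q₀` such
that `f q ≥ p₀` for all `q ≥ q₀`. -/
def TukeyLE (P : Type u) (Q : Type v) [Preorder P] [Preorder Q] : Prop :=
  ∃ f : Q → P, ∀ p₀ : P, ∃ q₀ : Q, ∀ q, q₀ ≤ q → p₀ ≤ f q

/-- Tukey equivalence. -/
def TukeyEquiv (P : Type u) (Q : Type v) [Preorder P] [Preorder Q] : Prop :=
  TukeyLE P Q ∧ TukeyLE Q P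

/-- The neighborhood filter of `a` as a directed set, ordered by containment: `M ≤ N` iff
`N ⊆ M`. -/
abbrev NhdsOrder {X : Type u} [TopologicalSpace X] (a : X) : Type u :=
  {N : Set X // N ∈ 𝓝 a}ᵒᵈ

/-! Everything rests on one local structure, `IsGrid`: clopen families of lengths `ω` and `ω₁`
exhaust the complement of `x`, with every pair of levels realized. By compactness the sets `(A n ∪ B
i)ᶜ` form a neighborhood base, and independence of the levels makes the Tukey type `ω × ω₁`
(`IsGrid.tukeyEquiv`). For points `a`, `b` with grids, relate `y` to `z` when their levels agree.
This relation is closed, total on both sides, and matches `a` exactly with `b`; the shift on its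
bi-infinite paths gives pin equivalence (`IsGrid.pinEquiv`).

Grids exist everywhere (`exists_isGrid`). The points below and above `f` in `2^{ω₁}_lex` are sorted
by the coordinates where `f` is 1, respectively 0. One of these coordinate sets is cofinal and
supplies the `ω₁` levels. The other side is absorbed into the family of matching length, and the
Cantor factor supplies the `ω` levels in all cases.

The grid bounds the `π`-character by `ω` and `ω₁`. A local `π`-base may use just one side of `f`: an
approach of type `ω` from below gives the value `ω`, while the greatest point has only an approach
of type `ω₁`. -/

/-! ### The ordinal `ω₁` as an index type -/

/-- The well-ordered set of countable ordinals. -/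
abbrev CountableOrd : Type := (ω₁ : Ordinal.{0}).ToType

theorem CountableOrd.mk_eq : #CountableOrd = ℵ₁ := by simp

instance : IsRegularCardinalOrder CountableOrd := ⟨by simp⟩

instance : NoMaxOrder CountableOrd := by
  refine ⟨fun a => ?_⟩
  have h : Order.succ ((Ordinal.ToType.mk.symm a : Set.Iio (ω₁ : Ordinal.{0})) : Ordinal) ∈
      Set.Iio (ω₁ : Ordinal.{0}) :=
    Set.mem_Iio.2 <|
    (Cardinal.isSuccLimit_omega 1).succ_lt (Set.mem_Iio.1 (Ordinal.ToType.mk.symm a).2)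
  refine ⟨Ordinal.ToType.mk ⟨_, h⟩, ?_⟩
  rw [← OrderIso.symm_apply_lt, ← Subtype.coe_lt_coe]
  exact Order.lt_succ _

instance : Nonempty CountableOrd := by
  rw [Ordinal.nonempty_toType_iff]
  exact (Ordinal.omega0_pos.trans Ordinal.omega0_lt_omega_one).ne'

theorem CountableOrd.countable_Iio (a : CountableOrd) : (Set.Iio a).Countable := by
  have h := Cardinal.mk_Iio_lt a (by simp)
  rw [CountableOrd.mk_eq, ← Cardinal.succ_aleph0, Order.lt_succ_iff] at h
  exact Cardinal.le_aleph0_iff_set_countable.1 h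

theorem CountableOrd.countable_of_not_isCofinal {s : Set CountableOrd} (h : ¬ IsCofinal s) :
    s.Countable := by
  obtain ⟨a, ha⟩ := not_isCofinal_iff.1 h
  exact (CountableOrd.countable_Iio a).mono ha

theorem CountableOrd.not_isCofinal_of_countable {s : Set CountableOrd} (h : s.Countable) :
    ¬ IsCofinal s := by
  intro hs
  have h1 := Order.cof_le hs
  rw [Order.cof_eq_cardinalMk, CountableOrd.mk_eq] at h1
  exact (h1.trans (Cardinal.le_aleph0_iff_set_countable.2 h)).not_gt Cardinal.aleph0_lt_aleph_one

/-! ### Grids -/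

/-- For an increasing family of sets, each point has a level at which it enters. -/
theorem Monotone.exists_level {X : Type u} {ι : Type v} [LinearOrder ι] [WellFoundedLT ι] {A : ι → Set X}
    (hA : Monotone A) (y : X) : ∃ n : WithTop ι, ∀ m : ι, y ∈ A m ↔ n ≤ m := by
  by_cases h : ∃ m, y ∈ A m
  · obtain ⟨m, hm, hmin⟩ := WellFounded.has_min (wellFounded_lt (α := ι)) {m | y ∈ A m} h
    refine ⟨m, fun k => ⟨fun hk => ?_, fun hk => hA (WithTop.coe_le_coe.1 hk) hm⟩⟩
    exact WithTop.coe_le_coe.2 (not_lt.1 (hmin k hk))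
  · push Not at h
    exact ⟨⊤, fun m => by simp [h m]⟩

section Grid

variable {X : Type u} [TopologicalSpace X]

/-- In a compact space, a directed open cover of the complement of a point yields a neighborhood
base of that point. -/
theorem exists_compl_subset_of_mem_nhds [CompactSpace X] {ι : Type v} [Nonempty ι] {x : X}
    {U : ι → Set X} (hU : ∀ i, IsOpen (U i)) (hd : Directed (· ⊆ ·) U)
    (hc : ∀ y, y ≠ x → ∃ i, y ∈ U i) {N : Set X} (hN : N ∈ 𝓝 x) : ∃ i, (U i)ᶜ ⊆ N := by
  obtain ⟨V, hVN, hV, hxV⟩ := mem_nhds_iff.1 hN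
  obtain ⟨i, hi⟩ := hV.isClosed_compl.isCompact.elim_directed_cover U hU
    (fun y hy => Set.mem_iUnion.2 (hc y fun h => hy (h ▸ hxV))) hd
  exact ⟨i, fun y hy => hVN (by_contra fun h => hy (hi h))⟩

/-- An `ω × ω₁` grid at a point `x`: two increasing families of clopen sets, indexed by `ω` and
`ω₁`, which together cover the complement of `x`, and such that all pairs of levels occur. -/
structure IsGrid (x : X) (A : ℕ → Set X) (B : CountableOrd → Set X) : Prop where
  isClopen_left : ∀ n, IsClopen (A n)
  isClopen_right : ∀ i, IsClopen (B i)
  monotone_left : Monotone A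
  monotone_right : Monotone B
  cover : ∀ y, y ≠ x → (∃ n, y ∈ A n) ∨ ∃ i, y ∈ B i
  realize : ∀ (n : WithTop ℕ) (i : WithTop CountableOrd),
    ∃ y, (∀ m : ℕ, y ∈ A m ↔ n ≤ m) ∧ ∀ j : CountableOrd, y ∈ B j ↔ i ≤ j

namespace IsGrid

variable {x : X} {A : ℕ → Set X} {B : CountableOrd → Set X}

theorem eq_of_forall_notMem (h : IsGrid x A B) {y : X} (hA : ∀ n, y ∉ A n) (hB : ∀ i, y ∉ B i) :
    y = x := by
  by_contra hy
  rcases h.cover y hy with ⟨n, hn⟩ | ⟨i, hi⟩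
  exacts [hA n hn, hB i hi]

/-- The point of level `(⊤, ⊤)` lies in no member of the families, so by `cover` it is `x` itself.
-/
theorem notMem (h : IsGrid x A B) : (∀ n, x ∉ A n) ∧ ∀ i, x ∉ B i := by
  obtain ⟨y, hyA, hyB⟩ := h.realize ⊤ ⊤
  have h1 : ∀ n, y ∉ A n := fun n hn => by simpa using (hyA n).1 hn
  have h2 : ∀ i, y ∉ B i := fun n hn => by simpa using (hyB n).1 hn
  exact h.eq_of_forall_notMem h1 h2 ▸ ⟨h1, h2⟩

theorem isClopen_compl (h : IsGrid x A B) (n : ℕ) (i : CountableOrd) :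
    IsClopen (A n ∪ B i)ᶜ :=
  ((h.isClopen_left n).union (h.isClopen_right i)).compl

theorem mem_compl (h : IsGrid x A B) (n : ℕ) (i : CountableOrd) : x ∈ (A n ∪ B i)ᶜ := by
  simp [h.notMem.1, h.notMem.2]

theorem compl_mem_nhds (h : IsGrid x A B) (n : ℕ) (i : CountableOrd) : (A n ∪ B i)ᶜ ∈ 𝓝 x :=
  (h.isClopen_compl n i).isOpen.mem_nhds (h.mem_compl n i)

theorem exists_compl_subset [CompactSpace X] (h : IsGrid x A B) {N : Set X} (hN : N ∈ 𝓝 x) :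
    ∃ n i, (A n ∪ B i)ᶜ ⊆ N := by
  have hm : Monotone fun q : ℕ × CountableOrd => A q.1 ∪ B q.2 := fun p q hpq =>
    Set.union_subset_union (h.monotone_left hpq.1) (h.monotone_right hpq.2)
  obtain ⟨q, hq⟩ := exists_compl_subset_of_mem_nhds (U := fun q : ℕ × CountableOrd => A q.1 ∪ B q.2)
    (fun q => ((h.isClopen_left q.1).union (h.isClopen_right q.2)).isOpen) hm.directed_le
    (fun y hy => by
      rcases h.cover y hy with ⟨n, hn⟩ | ⟨i, hi⟩
      · exact ⟨(n, Classical.arbitrary _), Or.inl hn⟩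
      · exact ⟨(0, i), Or.inr hi⟩) hN
  exact ⟨q.1, q.2, hq⟩

theorem tukeyEquiv [CompactSpace X] (h : IsGrid x A B) :
    TukeyEquiv (NhdsOrder x) (ℕ × CountableOrd) := by
  constructor
  · refine ⟨fun q => OrderDual.toDual ⟨(A q.1 ∪ B q.2)ᶜ, h.compl_mem_nhds q.1 q.2⟩, fun N => ?_⟩
    obtain ⟨n, i, hni⟩ := h.exists_compl_subset (OrderDual.ofDual N).2
    refine ⟨(n, i), fun q hq => ?_⟩
    change (A q.1 ∪ B q.2)ᶜ ⊆ (OrderDual.ofDual N).1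
    refine subset_trans (Set.compl_subset_compl.2 ?_) hni
    exact Set.union_subset_union (h.monotone_left hq.1) (h.monotone_right hq.2)
  -- `y n` has level `(n, ⊤)` and `z i` has level `(⊤, i)`. If a neighborhood avoids `A n ∪ B i`,
  -- each `y` in it has index above `n` and each `z` in it has index above `i`.
  · choose y hyA hyB using fun n : ℕ => h.realize n ⊤
    choose z hzA hzB using fun i : CountableOrd => h.realize ⊤ i
    have hy : ∀ N : NhdsOrder x, ∃ n, y n ∈ (OrderDual.ofDual N).1 := fun N => by
      obtain ⟨n, i, hni⟩ := h.exists_compl_subset (OrderDual.ofDual N).2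
      exact ⟨n + 1, hni (by simp [hyA, hyB, -Nat.cast_add])⟩
    have hz : ∀ N : NhdsOrder x, ∃ n, z n ∈ (OrderDual.ofDual N).1 := fun N => by
      obtain ⟨n, i, hni⟩ := h.exists_compl_subset (OrderDual.ofDual N).2
      obtain ⟨j, hj⟩ := exists_gt i
      exact ⟨j, hni (by simp [hzA, hzB, hj])⟩
    choose p hp using hy
    choose q hq using hz
    refine ⟨fun N => (p N, q N), fun r =>
      ⟨OrderDual.toDual ⟨(A r.1 ∪ B r.2)ᶜ, h.compl_mem_nhds r.1 r.2⟩, fun N hN => ?_⟩⟩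
    have hN' : (OrderDual.ofDual N).1 ⊆ (A r.1 ∪ B r.2)ᶜ := hN
    constructor
    · have h1 := hN' (hp N)
      simp only [Set.mem_compl_iff, Set.mem_union, hyA, not_or, not_le] at h1
      exact (WithTop.coe_lt_coe.1 h1.1).le
    · have h1 := hN' (hq N)
      simp only [Set.mem_compl_iff, Set.mem_union, hzB, not_or, not_le] at h1
      exact (WithTop.coe_lt_coe.1 h1.2).le

theorem exists_ne_mem [CompactSpace X] (h : IsGrid x A B) {U : Set X} (hU : IsOpen U)
    (hne : U.Nonempty) : ∃ y ∈ U, y ≠ x := by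
  obtain ⟨y, hy⟩ := hne
  by_cases hyx : y = x
  · obtain ⟨n, i, hni⟩ := h.exists_compl_subset (hU.mem_nhds (hyx ▸ hy))
    -- Level `n + 1` escapes `A n` and `B i` yet lies in `A (n + 1)`, which omits `x`.
    obtain ⟨z, hzA, hzB⟩ := h.realize (n + 1 : ℕ) ⊤
    refine ⟨z, hni (by simp [hzA, hzB, -Nat.cast_add]), ?_⟩
    rintro rfl
    exact h.notMem.1 (n + 1) ((hzA _).2 le_rfl)
  · exact ⟨y, hy, hyx⟩

theorem aleph0_le_piCharacter [CompactSpace X] [T1Space X] (h : IsGrid x A B) :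
    ℵ₀ ≤ piCharacter x := by
  refine le_csInf ⟨_, {U | IsOpen U ∧ U.Nonempty}, ⟨fun U hU => hU, fun N hN => ?_⟩, rfl⟩ ?_
  · exact ⟨interior N, ⟨isOpen_interior, x, mem_interior_iff_mem_nhds.2 hN⟩, interior_subset⟩
  · rintro _ ⟨F, hF, rfl⟩
    by_contra! hlt
    have hfin : Finite F := Cardinal.lt_aleph0_iff_finite.1 hlt
    choose y hyU hyx using fun U : F => h.exists_ne_mem (hF.1 U U.2).1 (hF.1 U U.2).2
    obtain ⟨U, hU, hUN⟩ := hF.2 (Set.range y)ᶜ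
      ((Set.finite_range y).isClosed.isOpen_compl.mem_nhds (by rintro ⟨U, hU⟩; exact hyx U hU))
    exact hUN (hyU ⟨U, hU⟩) ⟨_, rfl⟩

end IsGrid

theorem piCharacter_le {ι : Type u} {x : X} {U : ι → Set X}
    (hU : ∀ i, IsOpen (U i) ∧ (U i).Nonempty) (h : ∀ N ∈ 𝓝 x, ∃ i, U i ⊆ N) :
    piCharacter x ≤ #ι := by
  refine le_trans (csInf_le' ⟨Set.range U, ⟨?_, ?_⟩, rfl⟩) Cardinal.mk_range_le
  · rintro _ ⟨i, rfl⟩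
    exact hU i
  · intro N hN
    obtain ⟨i, hi⟩ := h N hN
    exact ⟨_, ⟨i, rfl⟩, hi⟩

theorem IsGrid.piCharacter_le_aleph_one {X : Type} [TopologicalSpace X] [CompactSpace X] {x : X}
    {A : ℕ → Set X} {B : CountableOrd → Set X} (h : IsGrid x A B) : piCharacter x ≤ ℵ₁ := by
  have h1 := piCharacter_le (ι := ℕ × CountableOrd) (x := x) (U := fun q => (A q.1 ∪ B q.2)ᶜ)
    (fun q => ⟨(h.isClopen_compl _ _).isOpen, x, h.mem_compl _ _⟩) (fun N hN => by
      obtain ⟨n, i, hni⟩ := h.exists_compl_subset hN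
      exact ⟨(n, i), hni⟩)
  rwa [Cardinal.mk_prod, Cardinal.lift_id, Cardinal.lift_id, Cardinal.mk_nat, CountableOrd.mk_eq,
    Cardinal.aleph0_mul_aleph] at h1

theorem IsClopen.isClosed_setOf_iff {S : Type v} [TopologicalSpace S] {U V : Set X}
    (hU : IsClopen U) (hV : IsClopen V) {f g : S → X} (hf : Continuous f) (hg : Continuous g) :
    IsClosed {s | f s ∈ U ↔ g s ∈ V} := by
  have : {s | f s ∈ U ↔ g s ∈ V} = (f ⁻¹' U ∩ g ⁻¹' V) ∪ ((f ⁻¹' U)ᶜ ∩ (g ⁻¹' V)ᶜ) := by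
    ext s
    simp only [Set.mem_ofPred_eq, Set.mem_union, Set.mem_inter_iff, Set.mem_preimage,
      Set.mem_compl_iff]
    tauto
  rw [this]
  have h1 := hU.preimage hf
  have h2 := hV.preimage hg
  exact ((h1.inter h2).union (h1.compl.inter h2.compl)).isClosed

/-- The shift on the bi-infinite sequences of `X` whose consecutive terms have equal levels in the
grids at `a` and `b` witnesses that `a` and `b` are pin equivalent. -/
theorem IsGrid.pinEquiv [CompactSpace X] [T2Space X] {a b : X} {A A' : ℕ → Set X}
    {B B' : CountableOrd → Set X} (ha : IsGrid a A B) (hb : IsGrid b A' B') : PinEquiv a b := by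
  let R : X → X → Prop := fun y z => (∀ m, y ∈ A m ↔ z ∈ A' m) ∧ ∀ j, y ∈ B j ↔ z ∈ B' j
  -- The centre of a grid is the only point outside all its members, so equality of levels preserves
  -- being the centre.
  have hab : ∀ {y z}, R y z → (y = a ↔ z = b) := by
    intro y z h
    constructor
    · rintro rfl
      exact hb.eq_of_forall_notMem (fun n hn => ha.notMem.1 n ((h.1 n).2 hn))
        fun n hn => ha.notMem.2 n ((h.2 n).2 hn)
    · rintro rfl
      exact ha.eq_of_forall_notMem (fun n hn => hb.notMem.1 n ((h.1 n).1 hn))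
        fun n hn => hb.notMem.2 n ((h.2 n).1 hn)
  have hright : ∀ y, ∃ z, R y z := fun y => by
    obtain ⟨n, hn⟩ := ha.monotone_left.exists_level y
    obtain ⟨i, hi⟩ := ha.monotone_right.exists_level y
    obtain ⟨z, hzA, hzB⟩ := hb.realize n i
    exact ⟨z, fun m => (hn m).trans (hzA m).symm, fun j => (hi j).trans (hzB j).symm⟩
  have hleft : ∀ z, ∃ y, R y z := fun z => by
    obtain ⟨n, hn⟩ := hb.monotone_left.exists_level z
    obtain ⟨i, hi⟩ := hb.monotone_right.exists_level z
    obtain ⟨y, hyA, hyB⟩ := ha.realize n i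
    exact ⟨y, fun m => (hyA m).trans (hn m).symm, fun j => (hyB j).trans (hi j).symm⟩
  choose r hr using hright
  choose l hl using hleft
  let S : Set (ℤ → X) := {s | ∀ k, R (s k) (s (k + 1))}
  have hS : IsClosed S := by
    have : S = ⋂ k : ℤ, (⋂ m, {s : ℤ → X | s k ∈ A m ↔ s (k + 1) ∈ A' m}) ∩
        ⋂ j, {s : ℤ → X | s k ∈ B j ↔ s (k + 1) ∈ B' j} := by
      ext s
      simp [S, R]
    rw [this]
    refine isClosed_iInter fun k => (isClosed_iInter fun m => ?_).inter (isClosed_iInter fun j => ?_)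
    · exact (ha.isClopen_left m).isClosed_setOf_iff (hb.isClopen_left m) (continuous_apply _)
        (continuous_apply _)
    · exact (ha.isClopen_right j).isClosed_setOf_iff (hb.isClopen_right j) (continuous_apply _)
        (continuous_apply _)
  let g : S ≃ₜ S :=
    { toFun := fun s => ⟨fun k => s.1 (k + 1), fun k => s.2 (k + 1)⟩
      invFun := fun s => ⟨fun k => s.1 (k - 1), fun k => by
        have := s.2 (k - 1)
        rwa [show k - 1 + 1 = k + 1 - 1 by ring] at this⟩
      left_inv := fun s => by ext k; simp
      right_inv := fun s => by ext k; simp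
      continuous_toFun := Continuous.subtype_mk (continuous_pi fun k =>
        (continuous_apply (k + 1 : ℤ)).comp (continuous_subtype_val (p := (· ∈ S)))) _
      continuous_invFun := Continuous.subtype_mk (continuous_pi fun k =>
        (continuous_apply (k - 1 : ℤ)).comp (continuous_subtype_val (p := (· ∈ S)))) _ }
  refine ⟨S, inferInstance, isCompact_iff_compactSpace.1 hS.isCompact, inferInstance,
    fun s => s.1 0, g, (continuous_apply (0 : ℤ)).comp continuous_subtype_val, fun y => ?_, ?_⟩
  -- Any `y` at index 0 extends forwards by `r` and backwards by `l`.
  · let s : ℤ → X := fun k => match k with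
      | Int.ofNat n => r^[n] y
      | Int.negSucc n => l^[n + 1] y
    refine ⟨⟨s, fun k => ?_⟩, rfl⟩
    match k with
    | Int.ofNat n =>
      change R (r^[n] y) (r^[n + 1] y)
      rw [Function.iterate_succ_apply']
      exact hr _
    | Int.negSucc 0 => exact hl y
    | Int.negSucc (n + 1) =>
      change R (l^[n + 1 + 1] y) (l^[n + 1] y)
      rw [Function.iterate_succ_apply' l (n + 1)]
      exact hl _
  · ext s
    rw [← Homeomorph.coe_toEquiv, Equiv.image_eq_preimage_symm]
    -- Index 0 of the inverse shift of `s` is `s (-1)`, which is `a` iff `s 0` is `b`.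
    have h := hab (s.2 (-1))
    exact h

end Grid

/-! ### First differences -/

/-- `β` is the first coordinate where `f` and `g` differ. -/
def IsFirstDiff {ι : Type u} [LinearOrder ι] (f g : ι → Bool) (β : ι) : Prop :=
  g β ≠ f β ∧ ∀ δ < β, g δ = f δ

section FirstDiff

variable {ι : Type u} [LinearOrder ι] {f g : ι → Bool} {β γ : ι}

theorem IsFirstDiff.le (h : IsFirstDiff f g β) (hγ : g γ ≠ f γ) : β ≤ γ :=
  not_lt.1 fun hlt => hγ (h.2 γ hlt)

theorem IsFirstDiff.unique (h : IsFirstDiff f g β) (h' : IsFirstDiff f g γ) : β = γ :=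
  (h.le h'.1).antisymm (h'.le h.1)

theorem exists_isFirstDiff [WellFoundedLT ι] (h : g ≠ f) : ∃ β, IsFirstDiff f g β := by
  obtain ⟨β, hβ, hmin⟩ := WellFounded.has_min (wellFounded_lt (α := ι)) {β | g β ≠ f β}
    (Function.ne_iff.1 h)
  exact ⟨β, hβ, fun δ hδ => by_contra fun hne => hmin δ hne hδ⟩

theorem isFirstDiff_update (f : ι → Bool) (β : ι) :
    IsFirstDiff f (Function.update f β (!f β)) β :=
  ⟨by simp, fun δ hδ => by simp [hδ.ne]⟩

end FirstDiff

/-! ### Clopen sets on the two sides of a point of `2^{ω₁}_lex` -/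

namespace LexPower

/-- The points of `2^{ω₁}_lex` as functions. -/
def toFun (f : LexPower ω₁) : CountableOrd → Bool := ofLex f

/-- Functions as points of `2^{ω₁}_lex`. -/
def ofFun (f : CountableOrd → Bool) : LexPower ω₁ := toLex f

@[simp] theorem toFun_ofFun (f : CountableOrd → Bool) : (ofFun f).toFun = f := rfl

theorem toFun_injective : Function.Injective toFun := fun _ _ h => h

noncomputable instance : CompactSpace (LexPower ω₁) :=
  @compactSpace_of_completeLinearOrder (LexPower ω₁)
    (inferInstanceAs (CompleteLinearOrder (Lex (CountableOrd → Bool)))) _ ⟨rfl⟩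

theorem lt_iff {f g : LexPower ω₁} :
    f < g ↔ ∃ β, IsFirstDiff g.toFun f.toFun β ∧ g.toFun β = true := by
  have h : f < g ↔ ∃ β, (∀ δ < β, f.toFun δ = g.toFun δ) ∧ f.toFun β < g.toFun β := Iff.rfl
  rw [h]
  refine exists_congr fun β => ?_
  rw [Bool.lt_iff, IsFirstDiff]
  constructor
  · rintro ⟨h1, h2, h3⟩
    exact ⟨⟨by simp [h2, h3], h1⟩, h3⟩
  · rintro ⟨⟨h1, h2⟩, h3⟩
    rw [h3] at h1
    exact ⟨h2, Bool.eq_false_iff.2 h1, h3⟩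

theorem gt_iff {f g : LexPower ω₁} :
    g < f ↔ ∃ β, IsFirstDiff g.toFun f.toFun β ∧ g.toFun β = false := by
  rw [lt_iff]
  refine exists_congr fun β => ?_
  simp only [IsFirstDiff, ne_eq, eq_comm (a := f.toFun _)]
  constructor
  · rintro ⟨⟨h1, h2⟩, h3⟩
    exact ⟨⟨h1, fun δ hδ => (h2 δ hδ)⟩, Bool.eq_false_iff.2 (h3 ▸ h1)⟩
  · rintro ⟨⟨h1, h2⟩, h3⟩
    exact ⟨⟨h1, fun δ hδ => (h2 δ hδ)⟩, by simpa [h3] using h1⟩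

/-- The points `g` that differ from `f` for the first time at a coordinate `γ ≤ β` with
`f γ = b`. -/
def near (f : LexPower ω₁) (b : Bool) (β : CountableOrd) : Set (LexPower ω₁) :=
  {g | ∃ γ ≤ β, f.toFun γ = b ∧ IsFirstDiff f.toFun g.toFun γ}

variable {f : LexPower ω₁} {b : Bool} {β : CountableOrd}

theorem near_mono (f : LexPower ω₁) (b : Bool) : Monotone (near f b) := fun _ _ h _ ⟨γ, hγ, hg⟩ =>
  ⟨γ, hγ.trans h, hg⟩

/-- `f` up to `β`, then the value `b` at `β`, then constantly `!b`. -/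
noncomputable def cut (f : LexPower ω₁) (b : Bool) (β : CountableOrd) : LexPower ω₁ :=
  ofFun fun δ => if δ < β then f.toFun δ else if δ = β then b else !b

theorem toFun_cut_of_lt {δ : CountableOrd} (h : δ < β) : (cut f b β).toFun δ = f.toFun δ := by
  simp [cut, h]

theorem toFun_cut_self : (cut f b β).toFun β = b := by simp [cut]

theorem toFun_cut_of_gt {δ : CountableOrd} (h : β < δ) : (cut f b β).toFun δ = !b := by
  simp [cut, h.not_gt, h.ne']

theorem toFun_cut_of_le (h : f.toFun β = b) {δ : CountableOrd} (hδ : δ ≤ β) :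
    (cut f b β).toFun δ = f.toFun δ := by
  rcases hδ.lt_or_eq with hlt | rfl
  · exact toFun_cut_of_lt hlt
  · rw [toFun_cut_self, h]

/-- These jumps are what make the rays `near f b β` clopen: nothing fits between `s0111…` and
`s1000…`. -/
theorem cut_covBy (f : LexPower ω₁) (β : CountableOrd) : cut f false β ⋖ cut f true β := by
  constructor
  · refine lt_iff.2 ⟨β, ⟨by simp [toFun_cut_self], fun δ hδ => ?_⟩, toFun_cut_self⟩
    rw [toFun_cut_of_lt hδ, toFun_cut_of_lt hδ]
  · intro g h1 h2
    obtain ⟨γ, hγ, hγb⟩ := gt_iff.1 h1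
    obtain ⟨δ, hδ, hδb⟩ := lt_iff.1 h2
    have hγβ : γ ≤ β := not_lt.1 fun h => by simp [toFun_cut_of_gt h] at hγb
    have hδβ : δ ≤ β := not_lt.1 fun h => by simp [toFun_cut_of_gt h] at hδb
    have hγ1 := hγ.1
    have hδ1 := hδ.1
    rcases lt_trichotomy γ δ with h | rfl | h
    · have := hδ.2 γ h
      rw [toFun_cut_of_lt (h.trans_le hδβ)] at this
      rw [toFun_cut_of_lt (h.trans_le hδβ)] at hγ1
      exact hγ1 this
    · rcases hγβ.lt_or_eq with h | rfl
      · rw [toFun_cut_of_lt h] at hγb hδb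
        simp [hγb] at hδb
      · rw [toFun_cut_self] at hγ1 hδ1
        cases hg : g.toFun γ <;> simp_all
    · have := hγ.2 δ h
      rw [toFun_cut_of_lt (h.trans_le hγβ)] at this
      rw [toFun_cut_of_lt (h.trans_le hγβ)] at hδ1
      exact hδ1 this

/-- Past `β` the point `cut f true β` is constantly 0, so anything smaller must first differ from it
at or before `β`, where it agrees with `f`. -/
theorem near_true (h : f.toFun β = true) : near f true β = Set.Iio (cut f true β) := by
  ext g
  rw [Set.mem_Iio, lt_iff]
  constructor
  · rintro ⟨γ, hγ, hγb, hd⟩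
    have hle : ∀ δ ≤ γ, (cut f true β).toFun δ = f.toFun δ := fun δ hδ =>
      toFun_cut_of_le h (hδ.trans hγ)
    refine ⟨γ, ⟨?_, fun δ hδ => ?_⟩, ?_⟩
    · rw [hle γ le_rfl]; exact hd.1
    · rw [hle δ hδ.le]; exact hd.2 δ hδ
    · rw [hle γ le_rfl]; exact hγb
  · rintro ⟨γ, hd, hγb⟩
    have hγ : γ ≤ β := not_lt.1 fun hlt => by simp [toFun_cut_of_gt hlt] at hγb
    have hle : ∀ δ ≤ γ, (cut f true β).toFun δ = f.toFun δ := fun δ hδ =>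
      toFun_cut_of_le h (hδ.trans hγ)
    refine ⟨γ, hγ, (hle γ le_rfl).symm.trans hγb, ?_, fun δ hδ => ?_⟩
    · rw [← hle γ le_rfl]; exact hd.1
    · rw [← hle δ hδ.le]; exact hd.2 δ hδ

theorem near_false (h : f.toFun β = false) : near f false β = Set.Ioi (cut f false β) := by
  ext g
  rw [Set.mem_Ioi, gt_iff]
  constructor
  · rintro ⟨γ, hγ, hγb, hd⟩
    have hle : ∀ δ ≤ γ, (cut f false β).toFun δ = f.toFun δ := fun δ hδ =>
      toFun_cut_of_le h (hδ.trans hγ)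
    refine ⟨γ, ⟨?_, fun δ hδ => ?_⟩, ?_⟩
    · rw [hle γ le_rfl]; exact hd.1
    · rw [hle δ hδ.le]; exact hd.2 δ hδ
    · rw [hle γ le_rfl]; exact hγb
  · rintro ⟨γ, hd, hγb⟩
    have hγ : γ ≤ β := not_lt.1 fun hlt => by simp [toFun_cut_of_gt hlt] at hγb
    have hle : ∀ δ ≤ γ, (cut f false β).toFun δ = f.toFun δ := fun δ hδ =>
      toFun_cut_of_le h (hδ.trans hγ)
    refine ⟨γ, hγ, (hle γ le_rfl).symm.trans hγb, ?_, fun δ hδ => ?_⟩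
    · rw [← hle γ le_rfl]; exact hd.1
    · rw [← hle δ hδ.le]; exact hd.2 δ hδ

theorem isClopen_near (h : f.toFun β = b) : IsClopen (near f b β) := by
  cases b
  · refine ⟨?_, ?_⟩ <;> rw [near_false h]
    · rw [(cut_covBy f β).Ioi_eq]; exact isClosed_Ici
    · exact isOpen_Ioi
  · refine ⟨?_, ?_⟩ <;> rw [near_true h]
    · rw [(cut_covBy f β).Iio_eq]; exact isClosed_Iic
    · exact isOpen_Iio

/-- `f` with the coordinate `β` flipped. -/
noncomputable def flip (f : LexPower ω₁) (β : CountableOrd) : LexPower ω₁ :=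
  ofFun (Function.update f.toFun β (!f.toFun β))

theorem isFirstDiff_flip (f : LexPower ω₁) (β : CountableOrd) :
    IsFirstDiff f.toFun (flip f β).toFun β :=
  isFirstDiff_update _ _

theorem flip_mem_near_iff {γ : CountableOrd} (h : f.toFun γ = b) :
    flip f γ ∈ near f b β ↔ γ ≤ β := by
  constructor
  · rintro ⟨δ, hδ, -, hd⟩
    exact (hd.unique (isFirstDiff_flip f γ)) ▸ hδ
  · exact fun hγ => ⟨γ, hγ, h, isFirstDiff_flip f γ⟩

theorem flip_notMem_near {γ : CountableOrd} (h : f.toFun γ ≠ b) : flip f γ ∉ near f b β := by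
  rintro ⟨δ, -, hδ, hd⟩
  exact h ((hd.unique (isFirstDiff_flip f γ)) ▸ hδ)

theorem self_notMem_near : f ∉ near f b β := by
  rintro ⟨δ, -, -, hd⟩
  exact hd.1 rfl

/-- The side of `f` consisting of the points that first differ from `f` at a coordinate of value
`b` is exhausted by increasing families of clopen sets of lengths `ω` and `ω₁`. -/
theorem exists_clopen_families (f : LexPower ω₁) (b : Bool) :
    ∃ (A : ℕ → Set (LexPower ω₁)) (B : CountableOrd → Set (LexPower ω₁)),
      (∀ n, IsClopen (A n)) ∧ (∀ i, IsClopen (B i)) ∧ Monotone A ∧ Monotone B ∧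
      (∀ g β, f.toFun β = b → IsFirstDiff f.toFun g.toFun β → (∃ n, g ∈ A n) ∨ ∃ i, g ∈ B i) ∧
      (∀ n, ∀ g ∈ A n, ∃ β, g ∈ near f b β) ∧ ∀ i, ∀ g ∈ B i, ∃ β, g ∈ near f b β := by
  by_cases hs : IsCofinal {β | f.toFun β = b}
  · have he : ∀ i, f.toFun (Order.enum _ hs i) = b := fun i => (Order.enum _ hs i).2
    refine ⟨fun _ => ∅, fun i => near f b (Order.enum _ hs i), fun _ => isClopen_empty,
      fun i => isClopen_near (he i), monotone_const,
      fun i j hij => near_mono f b ((Order.enum _ hs).monotone hij), ?_, by simp,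
      fun i g hg => ⟨_, hg⟩⟩
    intro g β hβ hd
    refine Or.inr ⟨(Order.enum _ hs).symm ⟨β, hβ⟩, β, ?_, hβ, hd⟩
    simp
  -- Here only countably many coordinates have value `b`; finite unions along an injection into `ℕ`
  -- give a family of length `ω`, with no need of a cofinal sequence.
  · have hc := CountableOrd.countable_of_not_isCofinal hs
    obtain ⟨e, he⟩ := Set.countable_iff_exists_injOn.1 hc
    have hfin : ∀ n, {β | f.toFun β = b ∧ e β ≤ n}.Finite := fun n =>
      Set.Finite.of_finite_image ((Set.finite_Iic n).subset (by rintro _ ⟨β, hβ, rfl⟩; exact hβ.2))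
        (he.mono fun β hβ => hβ.1)
    refine ⟨fun n => ⋃ β ∈ {β | f.toFun β = b ∧ e β ≤ n}, near f b β, fun _ => ∅,
      fun n => (hfin n).isClopen_biUnion fun β hβ => isClopen_near hβ.1, fun _ => isClopen_empty,
      fun m n hmn => Set.biUnion_subset_biUnion_left fun β hβ => ⟨hβ.1, hβ.2.trans hmn⟩,
      monotone_const, ?_, ?_, by simp⟩
    · intro g β hβ hd
      exact Or.inl ⟨e β, Set.mem_biUnion ⟨hβ, le_rfl⟩ ⟨β, le_rfl, hβ, hd⟩⟩
    · intro n g hg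
      obtain ⟨β, -, hg⟩ := Set.mem_iUnion₂.1 hg
      exact ⟨β, hg⟩

theorem exists_isCofinal (f : LexPower ω₁) : ∃ b, IsCofinal {β | f.toFun β = b} := by
  by_contra! h
  have h1 := (CountableOrd.countable_of_not_isCofinal (h true)).union
    (CountableOrd.countable_of_not_isCofinal (h false))
  refine CountableOrd.not_isCofinal_of_countable h1 (IsCofinal.univ.mono fun β _ => ?_)
  cases hβ : f.toFun β
  exacts [Or.inr hβ, Or.inl hβ]

end LexPower

/-! ### The Cantor factor and grids in the product -/

/-- The points of the Cantor space that differ from `c` at a coordinate at most `n`. -/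
def cantorNear (c : ℕ → Bool) (n : ℕ) : Set (ℕ → Bool) := {d | ∃ m ≤ n, d m ≠ c m}

theorem cantorNear_mono (c : ℕ → Bool) : Monotone (cantorNear c) := fun _ _ h _ ⟨k, hk, hd⟩ =>
  ⟨k, hk.trans h, hd⟩

theorem isClopen_cantorNear (c : ℕ → Bool) (n : ℕ) : IsClopen (cantorNear c n) := by
  have : cantorNear c n = ⋃ m ∈ Set.Iic n, (fun d : ℕ → Bool => d m) ⁻¹' {c m}ᶜ := by
    ext d
    simp only [cantorNear, Set.mem_ofPred_eq, Set.mem_iUnion, Set.mem_Iic, Set.mem_preimage,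
      Set.mem_compl_iff, Set.mem_singleton_iff, exists_prop, ne_eq]
  rw [this]
  exact (Set.finite_Iic n).isClopen_biUnion fun m _ =>
    (isClopen_discrete _).preimage (continuous_apply m)

theorem self_notMem_cantorNear (c : ℕ → Bool) (n : ℕ) : c ∉ cantorNear c n := by
  rintro ⟨m, -, hm⟩
  exact hm rfl

theorem exists_mem_cantorNear_iff (c : ℕ → Bool) (n : WithTop ℕ) :
    ∃ d, ∀ m : ℕ, d ∈ cantorNear c m ↔ n ≤ m := by
  induction n using WithTop.recTopCoe with
  | top => exact ⟨c, fun m => by simp [self_notMem_cantorNear]⟩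
  | coe n =>
    refine ⟨Function.update c n (!c n), fun m => ?_⟩
    refine Iff.trans ?_ WithTop.coe_le_coe.symm
    have h := isFirstDiff_update c n
    exact ⟨fun ⟨k, hk, hd⟩ => (h.le hd).trans hk, fun hm => ⟨n, hm, h.1⟩⟩

theorem exists_isGrid (x : CantorLexProduct) : ∃ A B, IsGrid x A B := by
  obtain ⟨c, f⟩ := x
  obtain ⟨b, hs⟩ := f.exists_isCofinal
  obtain ⟨A, B, hA, hB, hAm, hBm, hcover, hA', hB'⟩ := f.exists_clopen_families (!b)
  let e := Order.enum _ hs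
  have he : ∀ i, f.toFun (e i) = b := fun i => (e i).2
  have hnotMem : ∀ g, (∀ β, g ∉ f.near (!b) β) → (∀ n, g ∉ A n) ∧ ∀ i, g ∉ B i := fun g hg =>
    ⟨fun n hn => (hA' n g hn).elim hg, fun n hn => (hB' n g hn).elim hg⟩
  refine ⟨fun n => {y | y.1 ∈ cantorNear c n ∨ y.2 ∈ A n},
    fun i => {y | y.2 ∈ f.near b (e i) ∨ y.2 ∈ B i}, ?_, ?_, ?_, ?_, ?_, ?_⟩
  · exact fun n => ((isClopen_cantorNear c n).preimage continuous_fst).union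
      ((hA n).preimage continuous_snd)
  · exact fun i => ((LexPower.isClopen_near (he i)).preimage continuous_snd).union
      ((hB i).preimage continuous_snd)
  · exact fun m n hmn y hy => hy.imp (fun h => cantorNear_mono c hmn h) fun h => hAm hmn h
  · exact fun i j hij y hy => hy.imp (fun h => f.near_mono b (e.monotone hij) h) fun h => hBm hij h
  · rintro ⟨d, g⟩ hy
    by_cases hd : d = c
    · have hg : g ≠ f := fun hg => hy (by rw [hd, hg])
      obtain ⟨β, hβ⟩ := exists_isFirstDiff (LexPower.toFun_injective.ne hg)
      by_cases hb : f.toFun β = b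
      · refine Or.inr ⟨e.symm ⟨β, hb⟩, Or.inl ⟨β, ?_, hb, hβ⟩⟩
        simp
      · rcases hcover g β (Bool.eq_not_of_ne hb) hβ with ⟨n, hn⟩ | ⟨i, hi⟩
        exacts [Or.inl ⟨n, Or.inr hn⟩, Or.inr ⟨i, Or.inr hi⟩]
    · obtain ⟨n, hn⟩ := Function.ne_iff.1 hd
      exact Or.inl ⟨n, Or.inl ⟨n, le_rfl, hn⟩⟩
  -- The Cantor coordinate realizes `n`; flipping `f` at `e i` realizes `i` and stays off the `!b`
  -- side, so the absorbed families do not disturb the levels.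
  · intro n i
    obtain ⟨d, hd⟩ := exists_mem_cantorNear_iff c n
    induction i using WithTop.recTopCoe with
    | top =>
      have h := hnotMem f fun β => LexPower.self_notMem_near
      refine ⟨(d, f), fun m => ?_, fun j => ?_⟩
      · simp [hd, h.1]
      · simp [h.2, LexPower.self_notMem_near]
    | coe i =>
      have h := hnotMem (f.flip (e i)) fun β => LexPower.flip_notMem_near (by simp [he])
      refine ⟨(d, f.flip (e i)), fun m => ?_, fun j => ?_⟩
      · simp [hd, h.1]
      · simp [h.2, LexPower.flip_mem_near_iff (he i)]

/-! ### The two values of the `π`-character -/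

/-- The largest point of `2^{ω₁}_lex` has uncountable `π`-character in the product. -/
theorem aleph_one_le_piCharacter (c : ℕ → Bool) :
    ℵ₁ ≤ piCharacter ((c, LexPower.ofFun fun _ => true) : CantorLexProduct) := by
  set f : LexPower ω₁ := LexPower.ofFun fun _ => true with hf
  have hft : ∀ β, f.toFun β = true := fun _ => rfl
  have hiso : ∀ N ∈ 𝓝 f, ∃ g ∈ N, g ≠ f := fun N hN => by
    obtain ⟨i, hi⟩ := exists_compl_subset_of_mem_nhds (U := f.near true)
      (fun i => (LexPower.isClopen_near (hft i)).isOpen) (f.near_mono true).directed_le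
      (fun g hg => by
        obtain ⟨β, hβ⟩ := exists_isFirstDiff (LexPower.toFun_injective.ne hg)
        exact ⟨β, β, le_rfl, hft β, hβ⟩) hN
    obtain ⟨j, hj⟩ := exists_gt i
    refine ⟨f.flip j, hi fun h => hj.not_ge ((LexPower.flip_mem_near_iff (hft j)).1 h), fun h => ?_⟩
    exact (f.isFirstDiff_flip j).1 (by rw [h])
  have hne : ∀ U : Set CantorLexProduct, IsOpen U → U.Nonempty → ∃ y ∈ U, y.2 ≠ f := by
    rintro U hU ⟨⟨d, g⟩, hy⟩
    by_cases hg : g = f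
    · obtain ⟨g', hg', hne⟩ := hiso ((fun g => (d, g)) ⁻¹' U)
        ((hU.preimage (Continuous.prodMk_right d)).mem_nhds (by rwa [← hg]))
      exact ⟨(d, g'), hg', hne⟩
    · exact ⟨_, hy, hg⟩
  refine le_csInf ⟨_, {U | IsOpen U ∧ U.Nonempty}, ⟨fun U hU => hU, fun N hN => ?_⟩, rfl⟩ ?_
  · exact ⟨interior N, ⟨isOpen_interior, _, mem_interior_iff_mem_nhds.2 hN⟩, interior_subset⟩
  · rintro _ ⟨F, hF, rfl⟩
    by_contra! hlt
    rw [← Cardinal.succ_aleph0, Order.lt_succ_iff, Cardinal.mk_le_aleph0_iff] at hlt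
    choose y hyU hyf using fun U : F => hne U (hF.1 U U.2).1 (hF.1 U U.2).2
    choose β hβ using fun U : F => exists_isFirstDiff (LexPower.toFun_injective.ne (hyf U))
    -- Countably many first differences are bounded by some `γ`, and the neighborhood of points
    -- agreeing with `f` up to `γ` excludes every chosen `y U`.
    obtain ⟨γ, hγ⟩ := not_isCofinal_iff.1
      (CountableOrd.not_isCofinal_of_countable (Set.countable_range β))
    obtain ⟨U, hU, hUN⟩ := hF.2 (Prod.snd ⁻¹' (f.near true γ)ᶜ)
      (((LexPower.isClopen_near (hft γ)).compl.isOpen.preimage continuous_snd).mem_nhds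
        LexPower.self_notMem_near)
    exact hUN (hyU ⟨U, hU⟩) ⟨_, (hγ _ ⟨⟨U, hU⟩, rfl⟩).le, hft _, hβ _⟩

/-- The finite ordinals as countable ordinals. -/
noncomputable def CountableOrd.ofNat (n : ℕ) : CountableOrd :=
  Ordinal.ToType.mk ⟨n, (Ordinal.natCast_lt_omega0 n).trans Ordinal.omega0_lt_omega_one⟩

theorem CountableOrd.ofNat_strictMono : StrictMono CountableOrd.ofNat := fun _ _ h =>
  Ordinal.ToType.mk.strictMono (Subtype.mk_lt_mk.2 (Nat.cast_lt.2 h))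

open Classical in
/-- The supremum of the points `1ⁿ000…` has countable `π`-character in the product. -/
theorem piCharacter_le_aleph0 (c : ℕ → Bool) :
    piCharacter ((c, LexPower.ofFun fun β => decide (β ∈ Set.range CountableOrd.ofNat)) :
      CantorLexProduct) ≤ ℵ₀ := by
  set f : LexPower ω₁ := LexPower.ofFun fun β => decide (β ∈ Set.range CountableOrd.ofNat) with hf
  have hft : ∀ n, f.toFun (CountableOrd.ofNat n) = true := fun n => decide_eq_true (Set.mem_range_self n)
  have hft' : ∀ β, f.toFun β = true → β ∈ Set.range CountableOrd.ofNat := fun β hβ =>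
    of_decide_eq_true hβ
  -- `Q n` consists of the points first differing from `f` at coordinate `n + 1`; these sets lie
  -- below `f` and converge to it.
  let Q : ℕ → Set (LexPower ω₁) := fun n =>
    f.near true (CountableOrd.ofNat (n + 1)) \ f.near true (CountableOrd.ofNat n)
  have hQ : ∀ n, IsOpen (Q n) := fun n =>
    ((LexPower.isClopen_near (hft _)).diff (LexPower.isClopen_near (hft _))).isOpen
  have h := piCharacter_le (ι := ℕ × ℕ) (x := ((c, f) : CantorLexProduct))
    (U := fun q => (cantorNear c q.1)ᶜ ×ˢ Q q.2) (fun q => ⟨?_, ?_⟩) fun N hN => ?_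
  · simpa using h
  · exact (isClopen_cantorNear c q.1).compl.isOpen.prod (hQ q.2)
  · refine ⟨(c, f.flip (CountableOrd.ofNat (q.2 + 1))), self_notMem_cantorNear c _, ?_, ?_⟩
    · exact (LexPower.flip_mem_near_iff (hft _)).2 le_rfl
    · exact fun h => (CountableOrd.ofNat_strictMono q.2.lt_succ_self).not_ge
        ((LexPower.flip_mem_near_iff (hft _)).1 h)
  · obtain ⟨u, hu, v, hv, huv⟩ := mem_nhds_prod_iff.1 hN
    obtain ⟨m, hm⟩ := exists_compl_subset_of_mem_nhds (fun n => (isClopen_cantorNear c n).isOpen)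
      (cantorNear_mono c).directed_le
      (fun d hd => by
        obtain ⟨n, hn⟩ := Function.ne_iff.1 hd
        exact ⟨n, n, le_rfl, hn⟩) hu
    obtain ⟨g, hg, hgv⟩ := exists_Ioc_subset_of_mem_nhds hv
      ⟨_, LexPower.lt_iff.2 ⟨_, f.isFirstDiff_flip (CountableOrd.ofNat 0), hft 0⟩⟩
    obtain ⟨β, hβ, hβt⟩ := LexPower.lt_iff.1 hg
    obtain ⟨n, rfl⟩ := hft' β hβt
    refine ⟨(m, n), (Set.prod_mono hm fun k hk => hgv ⟨?_, ?_⟩).trans huv⟩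
    · by_contra hkg
      have hk1 : k ∈ f.near true (CountableOrd.ofNat n) := by
        rw [LexPower.near_true (hft n)]
        rw [not_lt] at hkg
        refine hkg.trans_lt ?_
        rw [← Set.mem_Iio, ← LexPower.near_true (hft n)]
        exact ⟨_, le_rfl, hft n, hβ⟩
      exact hk.2 hk1
    · obtain ⟨γ, -, hγt, hγ⟩ := hk.1
      exact (LexPower.lt_iff.2 ⟨γ, hγ, hγt⟩).le

/-- `K = 2^ω × 2^{ω₁}_lex` is a compact Hausdorff space and is pin homogeneous; each of its points
has `π`-character `ω` or `ω₁`, and both values occur; and every point of `K` has Tukey type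
`ω × ω₁` (the product with the coordinatewise order). -/
theorem mainTheorem9 :
    CompactSpace CantorLexProduct ∧ T2Space CantorLexProduct ∧
      PinHomogeneous CantorLexProduct ∧
      (∀ x : CantorLexProduct, piCharacter x = ℵ₀ ∨ piCharacter x = ℵ₁) ∧
      (∃ x : CantorLexProduct, piCharacter x = ℵ₀) ∧
      (∃ x : CantorLexProduct, piCharacter x = ℵ₁) ∧
      (∀ x : CantorLexProduct, TukeyEquiv (NhdsOrder x) (ℕ × (ω₁ : Ordinal.{0}).ToType)) := by
  have hge : ∀ x : CantorLexProduct, ℵ₀ ≤ piCharacter x := fun x => by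
    obtain ⟨A, B, h⟩ := exists_isGrid x
    exact h.aleph0_le_piCharacter
  have hle : ∀ x : CantorLexProduct, piCharacter x ≤ ℵ₁ := fun x => by
    obtain ⟨A, B, h⟩ := exists_isGrid x
    exact h.piCharacter_le_aleph_one
  refine ⟨inferInstance, inferInstance, fun a b => ?_, fun x => ?_, ?_, ?_, fun x => ?_⟩
  · obtain ⟨A, B, ha⟩ := exists_isGrid a
    obtain ⟨A', B', hb⟩ := exists_isGrid b
    exact ha.pinEquiv hb
  · rcases (hge x).eq_or_lt with h | h
    · exact Or.inl h.symm
    · refine Or.inr ((hle x).antisymm ?_)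
      rw [← Cardinal.succ_aleph0]
      exact Order.succ_le_of_lt h
  · exact ⟨_, (piCharacter_le_aleph0 fun _ => false).antisymm (hge _)⟩
  · exact ⟨_, (hle _).antisymm (aleph_one_le_piCharacter fun _ => false)⟩
  · obtain ⟨A, B, h⟩ := exists_isGrid x
    exact h.tukeyEquiv
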